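/- Let $p$ be a prime number and let $\overline{\mathbb F_p}$ be an algebraic closure of the field $\mathbb F_p$ with $p$ elements. For formal power series $A=\sum_{n\ge 0}\alpha_nX^n$ and $B=\sum_{n\ge 0}\beta_nX^n$ in $\overline{\mathbb F_p}[[X]]$, their shuffle product is $$A \mathbin{\sqcup\!\sqcup} B=\sum_{n,m\ge 0}\binom{n+m}{n}\alpha_n\beta_m X^{n+m}.$$ A series $y\in\overline{\mathbb F_p}[[X]]$ is called algebraic if $P(X,y)=0$ for some nonzero polynomial $P(X,Y)\in\overline{\mathbb F_p}[X,Y]$. If $A,B\in\overline{\mathbb F_p}[[X]]$ are algebraic, then $A \mathbin{\sqcup\!\sqcup} B$ is algebraic. -/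

import Mathlib

namespace PowerSeries

/-- The shuffle product of two formal power series in one variable: if `A = ∑ αₙ Xⁿ` and
`B = ∑ βₙ Xⁿ`, then `shuffle A B = ∑ₙ (∑_{i + j = n} (i + j choose i) αᵢ βⱼ) Xⁿ`. -/
noncomputable def shuffle {K : Type*} [CommSemiring K] (A B : PowerSeries K) : PowerSeries K :=
  PowerSeries.mk fun n =>
    ∑ ij ∈ Finset.HasAntidiagonal.antidiagonal n,
      ((ij.1 + ij.2).choose ij.1 : K) * PowerSeries.coeff ij.1 A * PowerSeries.coeff ij.2 B

end PowerSeries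

/-! The argument follows Christol: over a perfect field `K` of characteristic `p`, a series is
algebraic exactly when it lies in a finite-dimensional `K`-subspace stable under all Cartier
operators with index `i < p` (`exists_cartier_stable_of_isAlgebraic`,
`isAlgebraic_of_mem_cartier_stable`). By Lucas's congruence, a Cartier operator turns a shuffle into
a combination of shuffles of Cartier transforms (`cartier_shuffle`). Hence if `V` and `W` are such
spaces for `A` and `B`, the span of all shuffles of `V` with `W` is again one, and it contains the
shuffle of `A` and `B`. -/

namespace PowerSeries

variable {K : Type*} [Field K] (p : ℕ) [Fact p.Prime] [CharP K p]

/-! ### Cartier operators on power series -/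

section Cartier

variable [PerfectRing K p]

/-- The Cartier operator `∑ αₙ Xⁿ ↦ ∑ (α_{pn+i})^{1/p} Xⁿ` on power series over a perfect field. -/
noncomputable def cartier (i : ℕ) : PowerSeries K →+ PowerSeries K where
  toFun F := PowerSeries.mk fun n => (frobeniusEquiv K p).symm (coeff (p * n + i) F)
  map_zero' := by ext; simp
  map_add' F G := by ext; simp

@[simp]
theorem coeff_cartier (i n : ℕ) (F : PowerSeries K) :
    coeff n (cartier p i F) = (frobeniusEquiv K p).symm (coeff (p * n + i) F) := by
  simp [cartier]

theorem cartier_smul (i : ℕ) (c : K) (F : PowerSeries K) :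
    cartier p i (c • F) = (frobeniusEquiv K p).symm c • cartier p i F := by
  ext n
  simp

omit [PerfectRing K p] in
theorem map_frobenius_expand (hp : p ≠ 0) (F : PowerSeries K) :
    (F.expand p hp).map (frobenius K p) = F ^ p :=
  MvPowerSeries.map_frobenius_expand p hp

omit [PerfectRing K p] in
theorem coeff_pow_char_mul (F : PowerSeries K) (n : ℕ) :
    coeff (p * n) (F ^ p) = coeff n F ^ p := by
  have hp : p ≠ 0 := (Fact.out : p.Prime).ne_zero
  rw [← map_frobenius_expand p hp, coeff_map, coeff_expand_mul, frobenius_def]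

omit [PerfectRing K p] in
theorem coeff_pow_char_of_not_dvd (F : PowerSeries K) {n : ℕ} (h : ¬ p ∣ n) :
    coeff n (F ^ p) = 0 := by
  have hp : p ≠ 0 := (Fact.out : p.Prime).ne_zero
  rw [← map_frobenius_expand p hp, coeff_map, coeff_expand_of_not_dvd _ _ _ h, map_zero]

/-- `F ^ p` has only exponents divisible by `p`, so the exponents `≡ i` mod `p` in the product come
from those of `G` alone. -/
theorem cartier_mul_pow_char {i : ℕ} (hi : i < p) (G F : PowerSeries K) :
    cartier p i (G * F ^ p) = cartier p i G * F := by
  have hp : 0 < p := (Fact.out : p.Prime).pos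
  ext n
  rw [coeff_cartier, coeff_mul, coeff_mul, map_sum]
  symm
  refine Finset.sum_of_injOn (fun x => (p * x.1 + i, p * x.2)) ?_ ?_ ?_ ?_
  · rintro ⟨a, b⟩ _ ⟨c, d⟩ _ h
    simp only [Prod.mk.injEq] at h
    have h1 := Nat.eq_of_mul_eq_mul_left hp h.2
    have h2 := Nat.eq_of_mul_eq_mul_left hp (Nat.add_right_cancel h.1)
    simp [h1, h2]
  · rintro ⟨a, b⟩ h
    simp only [Finset.mem_coe, Finset.HasAntidiagonal.mem_antidiagonal] at h ⊢
    rw [← h]; ring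
  · rintro ⟨a, b⟩ h hn
    rw [Finset.HasAntidiagonal.mem_antidiagonal] at h
    by_cases hb : p ∣ b
    · exfalso
      apply hn
      obtain ⟨d, rfl⟩ := hb
      simp only at h
      have hd : d ≤ n := by
        by_contra hlt
        have : p * (n + 1) ≤ p * d := Nat.mul_le_mul_left p (by omega)
        rw [mul_add] at this
        omega
      refine ⟨(n - d, d), ?_, ?_⟩
      · simp; omega
      · have : p * (n - d) + p * d = p * n := by rw [← mul_add]; congr 1; omega
        simp only [Prod.mk.injEq, and_true]
        omega
    · simp [coeff_pow_char_of_not_dvd p F hb]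
  · rintro ⟨a, b⟩ _
    simp only [coeff_cartier, coeff_pow_char_mul, map_mul]
    rw [← frobenius_def p (coeff b F), frobeniusEquiv_symm_apply_frobenius]

theorem eq_sum_X_pow_mul_cartier_pow (F : PowerSeries K) :
    F = ∑ i ∈ Finset.range p, X ^ i * cartier p i F ^ p := by
  have hp : 0 < p := (Fact.out : p.Prime).pos
  ext n
  rw [map_sum, Finset.sum_eq_single (n % p)]
  · rw [coeff_X_pow_mul', if_pos (Nat.mod_le n p)]
    have h : n - n % p = p * (n / p) := by
      have := Nat.div_add_mod n p
      omega
    rw [h, coeff_pow_char_mul, coeff_cartier, frobeniusEquiv_symm_pow_p, Nat.div_add_mod]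
  · intro i hi hne
    rw [coeff_X_pow_mul']
    split_ifs with hle
    · apply coeff_pow_char_of_not_dvd
      intro hd
      apply hne
      rw [← Nat.mod_eq_of_lt (Finset.mem_range.mp hi)]
      exact (Nat.modEq_iff_dvd' hle).mpr hd
    · rfl
  · intro h
    exact absurd (Finset.mem_range.mpr (Nat.mod_lt n hp)) h

theorem exists_cartier_ne_zero {F : PowerSeries K} (hF : F ≠ 0) :
    ∃ i < p, cartier p i F ≠ 0 := by
  by_contra! h
  apply hF
  rw [eq_sum_X_pow_mul_cartier_pow p F]
  refine Finset.sum_eq_zero fun i hi => ?_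
  rw [h i (Finset.mem_range.mp hi), zero_pow (Fact.out : p.Prime).ne_zero, mul_zero]

end Cartier

/-! ### Cartier operators and shuffles -/

section Shuffle

variable [PerfectRing K p]

omit [PerfectRing K p] in
theorem natCast_choose_mul_add {i j : ℕ} (hi : i < p) (hj : j < p) (n m : ℕ) :
    ((p * n + i).choose (p * m + j) : K) = (n.choose m : K) * (i.choose j : K) := by
  have hp : 0 < p := (Fact.out : p.Prime).pos
  have h := Choose.choose_modEq_choose_mod_mul_choose_div_nat (p := p) (n := p * n + i)
    (k := p * m + j)
  rw [Nat.mul_add_mod, Nat.mul_add_mod, Nat.mod_eq_of_lt hi, Nat.mod_eq_of_lt hj,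
    Nat.mul_add_div hp, Nat.mul_add_div hp, Nat.div_eq_of_lt hi, Nat.div_eq_of_lt hj] at h
  rw [(CharP.natCast_eq_natCast K p).mpr h]
  simp [mul_comm]

/-- Lucas splits each binomial into a lower-digit factor `i.choose j` and the binomial of a shuffle;
both lie in the prime field, so the `p`-th root fixes them. -/
theorem cartier_shuffle {i : ℕ} (hi : i < p) (A B : PowerSeries K) :
    cartier p i (shuffle A B) =
      ∑ j ∈ Finset.range (i + 1),
        (i.choose j : K) • shuffle (cartier p j A) (cartier p (i - j) B) := by
  have hp : 0 < p := (Fact.out : p.Prime).pos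
  ext n
  simp only [coeff_cartier, shuffle, coeff_mk, map_sum, coeff_smul, smul_eq_mul, Finset.mul_sum]
  rw [← Finset.sum_product']
  symm
  refine Finset.sum_of_injOn (fun x => (p * x.2.1 + x.1, p * x.2.2 + (i - x.1))) ?_ ?_ ?_ ?_
  · rintro ⟨j, a, b⟩ h ⟨k, c, d⟩ h' he
    simp only [Finset.coe_product, Set.mem_prod, Finset.mem_coe, Finset.mem_range,
      Finset.HasAntidiagonal.mem_antidiagonal] at h h'
    simp only [Prod.mk.injEq] at he
    have h1 := congrArg (· % p) he.1
    simp only [Nat.mul_add_mod, Nat.mod_eq_of_lt (show j < p by omega),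
      Nat.mod_eq_of_lt (show k < p by omega)] at h1
    subst h1
    have h2 := Nat.eq_of_mul_eq_mul_left hp (Nat.add_right_cancel he.1)
    have h3 := Nat.eq_of_mul_eq_mul_left hp (Nat.add_right_cancel he.2)
    simp [h2, h3]
  · rintro ⟨j, a, b⟩ h
    simp only [Finset.coe_product, Set.mem_prod, Finset.mem_coe, Finset.mem_range,
      Finset.HasAntidiagonal.mem_antidiagonal] at h ⊢
    rw [← h.2, mul_add]
    omega
  · rintro ⟨a, b⟩ h hn
    rw [Finset.HasAntidiagonal.mem_antidiagonal] at h
    simp only at h ⊢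
    -- The terms not matched are those where adding `a` and `b` carries out of the last base-`p`
    -- digit; there Lucas gives the factor `i.choose (a % p) = 0`.
    have hlt : i < a % p := by
      by_contra! hle
      apply hn
      have ha := Nat.div_add_mod a p
      have hd : a / p ≤ n := by
        by_contra hlt
        have : p * (n + 1) ≤ p * (a / p) := Nat.mul_le_mul_left p (by omega)
        rw [mul_add] at this
        omega
      refine ⟨(a % p, a / p, n - a / p), ?_, ?_⟩
      · simp only [Finset.coe_product, Set.mem_prod, Finset.mem_coe, Finset.mem_range,
          Finset.HasAntidiagonal.mem_antidiagonal]
        omega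
      · have : p * (n - a / p) + p * (a / p) = p * n := by rw [← mul_add]; congr 1; omega
        simp only [Prod.mk.injEq]
        omega
    have hc : ((a + b).choose a : K) = 0 := by
      have := natCast_choose_mul_add (K := K) p hi (Nat.mod_lt a hp) n (a / p)
      rw [Nat.div_add_mod] at this
      rw [h, this, Nat.choose_eq_zero_of_lt hlt]
      simp
    simp [hc]
  · rintro ⟨j, a, b⟩ h
    simp only [Finset.mem_product, Finset.mem_range, Finset.HasAntidiagonal.mem_antidiagonal] at h
    have hs : p * a + j + (p * b + (i - j)) = p * (a + b) + i := by rw [mul_add]; omega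
    rw [hs, natCast_choose_mul_add p hi (by omega)]
    simp only [map_mul, map_natCast]
    ring

/-- The shuffle product as a bilinear map. -/
noncomputable def shuffleBilin : PowerSeries K →ₗ[K] PowerSeries K →ₗ[K] PowerSeries K :=
  LinearMap.mk₂ K shuffle
    (fun A A' B => by
      ext n; simp [shuffle, mul_add, add_mul, Finset.sum_add_distrib])
    (fun c A B => by
      ext n
      simp only [shuffle, coeff_mk, coeff_smul, smul_eq_mul, Finset.mul_sum]
      exact Finset.sum_congr rfl fun _ _ => by ring)
    (fun A B B' => by
      ext n; simp [shuffle, mul_add, Finset.sum_add_distrib])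
    (fun c A B => by
      ext n
      simp only [shuffle, coeff_mk, coeff_smul, smul_eq_mul, Finset.mul_sum]
      exact Finset.sum_congr rfl fun _ _ => by ring)

theorem cartier_mem_map₂_shuffleBilin {V W : Submodule K (PowerSeries K)}
    (hV : ∀ i < p, ∀ F ∈ V, cartier p i F ∈ V) (hW : ∀ i < p, ∀ F ∈ W, cartier p i F ∈ W)
    {i : ℕ} (hi : i < p) {F : PowerSeries K} (hF : F ∈ Submodule.map₂ shuffleBilin V W) :
    cartier p i F ∈ Submodule.map₂ shuffleBilin V W := by
  rw [Submodule.map₂_eq_span_image2] at hF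
  induction hF using Submodule.span_induction with
  | mem F hF =>
    obtain ⟨A, hA, B, hB, rfl⟩ := hF
    change cartier p i (shuffle A B) ∈ _
    rw [cartier_shuffle p hi]
    refine Submodule.sum_mem _ fun j hj => Submodule.smul_mem _ _ ?_
    rw [Finset.mem_range] at hj
    exact Submodule.apply_mem_map₂ shuffleBilin (hV j (by omega) A hA)
      (hW (i - j) (by omega) B hB)
  | zero => simp
  | add F G _ _ hF hG => rw [map_add]; exact add_mem hF hG
  | smul c F _ hF => rw [cartier_smul]; exact Submodule.smul_mem _ _ hF

end Shuffle

/-! ### Algebraicity and Cartier-stable spaces -/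

section Algebraic

theorem pow_char_mem_span_pow_char {ι : Type*} {w : ι → PowerSeries K}
    {F : PowerSeries K}
    (hF : F ∈ Submodule.span (Polynomial K) (Set.range w)) :
    F ^ p ∈ Submodule.span (Polynomial K) (Set.range fun l => w l ^ p) := by
  have : CharP (PowerSeries K) p := charP_of_injective_algebraMap (algebraMap K _).injective p
  induction hF using Submodule.span_induction with
  | mem F hF =>
    obtain ⟨l, rfl⟩ := hF
    exact Submodule.subset_span ⟨l, rfl⟩
  | zero => simp [(Fact.out : p.Prime).ne_zero]
  | add F G _ _ hF hG => rw [add_pow_char]; exact add_mem hF hG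
  | smul c F _ hF => rw [smul_pow]; exact Submodule.smul_mem _ _ hF

theorem pow_char_pow_mem_span {ι : Type*} {w : ι → PowerSeries K} {F : PowerSeries K}
    (hF : F ∈ Submodule.span (Polynomial K) (Set.range w)) (m : ℕ) :
    F ^ p ^ m ∈ Submodule.span (Polynomial K) (Set.range fun l => w l ^ p ^ m) := by
  induction m with
  | zero => simpa using hF
  | succ m ih => simpa only [pow_succ, pow_mul] using pow_char_mem_span_pow_char p ih

/-- Iterate `F = ∑ X ^ i * cartier p i F ^ p`: stability keeps every transform in the span of `w`,
and each round adds one Frobenius twist. -/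
theorem mem_span_pow_char_pow [PerfectRing K p] {ι : Type*} {w : ι → PowerSeries K}
    (hw : ∀ i < p, ∀ F ∈ Submodule.span K (Set.range w),
      cartier p i F ∈ Submodule.span K (Set.range w))
    (m : ℕ) {F : PowerSeries K} (hF : F ∈ Submodule.span K (Set.range w)) :
    F ∈ Submodule.span (Polynomial K) (Set.range fun l => w l ^ p ^ m) := by
  induction m generalizing F with
  | zero =>
    simpa using Submodule.span_le_restrictScalars K (Polynomial K) (Set.range w) hF
  | succ m ih =>
    rw [eq_sum_X_pow_mul_cartier_pow p F]
    refine Submodule.sum_mem _ fun i hi => ?_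
    have h := pow_char_mem_span_pow_char p (ih (hw i (Finset.mem_range.mp hi) F hF))
    simp only [← pow_mul, ← pow_succ] at h
    have h2 := Submodule.smul_mem _ ((Polynomial.X : Polynomial K) ^ i) h
    simpa [Algebra.smul_def, algebraMap_apply'] using h2

theorem isAlgebraic_of_sum_mul_pow_eq_zero {R S : Type*} [CommRing R] [CommRing S] [Algebra R S]
    {A : S} {m : ℕ} {e : Fin m → ℕ} (he : Function.Injective e) {g : Fin m → R}
    (hg : ∑ j, g j • A ^ e j = 0) {i : Fin m} (hi : g i ≠ 0) : IsAlgebraic R A := by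
  refine ⟨∑ j, Polynomial.monomial (e j) (g j), fun h => hi ?_, ?_⟩
  · have := congrArg (Polynomial.coeff · (e i)) h
    simpa [Polynomial.finsetSum_coeff, Polynomial.coeff_monomial, he.eq_iff] using this
  · simpa [Polynomial.aeval_monomial, Algebra.smul_def] using hg

/-- Expanding `A` in the `w l ^ p ^ (d - j)` and raising to the power `p ^ j` puts all of `A ^ p ^
j`, `j ≤ d`, in one module with `d` generators. These `d + 1` elements are therefore dependent. -/
theorem isAlgebraic_of_mem_cartier_stable [PerfectRing K p] {V : Submodule K (PowerSeries K)}
    (hfin : V.FG) (hV : ∀ i < p, ∀ F ∈ V, cartier p i F ∈ V)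
    {A : PowerSeries K} (hA : A ∈ V) : IsAlgebraic (Polynomial K) A := by
  obtain ⟨d, w, rfl⟩ := Submodule.fg_iff_exists_fin_generating_family.mp hfin
  have key : ∀ j : Fin (d + 1),
      A ^ p ^ (j : ℕ) ∈ Submodule.span (Polynomial K) (Set.range fun l => w l ^ p ^ d) := by
    intro j
    have h := pow_char_pow_mem_span p (mem_span_pow_char_pow p hV (d - j) hA) j
    simpa only [← pow_mul, ← pow_add, Nat.sub_add_cancel (Nat.lt_succ_iff.mp j.2)] using h
  have hdep : ¬ LinearIndependent (Polynomial K) fun j : Fin (d + 1) => A ^ p ^ (j : ℕ) := by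
    classical
    intro hli
    have := linearIndependent_le_span_aux' _ hli _ (Set.range_subset_iff.mpr key)
    have h2 := Fintype.card_range_le (fun l : Fin d => w l ^ p ^ d)
    simp at this h2
    omega
  obtain ⟨g, hg, i, hi⟩ := Fintype.not_linearIndependent_iff.mp hdep
  refine isAlgebraic_of_sum_mul_pow_eq_zero ?_ hg hi
  exact (Nat.pow_right_injective (Fact.out : p.Prime).two_le).comp Fin.val_injective

/-- The polynomials of degree at most `D`, as power series. -/
def degreeLE (K : Type*) [Field K] (D : ℕ) : Submodule K (PowerSeries K) where
  carrier := {F | ∀ n, D < n → coeff n F = 0}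
  zero_mem' := by simp
  add_mem' hF hG n hn := by simp [hF n hn, hG n hn]
  smul_mem' c F hF n hn := by simp [hF n hn]

theorem mem_degreeLE {D : ℕ} {F : PowerSeries K} :
    F ∈ degreeLE K D ↔ ∀ n, D < n → coeff n F = 0 := Iff.rfl

theorem degreeLE_fg (D : ℕ) : (degreeLE K D).FG := by
  classical
  have h : degreeLE K D ≤
      Submodule.span K (((Finset.range (D + 1)).image fun n => (X : PowerSeries K) ^ n : Finset _) :
        Set (PowerSeries K)) := by
    intro F hF
    have : F = ∑ n ∈ Finset.range (D + 1), coeff n F • X ^ n := by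
      ext m
      simp only [map_sum, coeff_smul, coeff_X_pow, smul_eq_mul, mul_ite, mul_one, mul_zero,
        Finset.sum_ite_eq, Finset.mem_range]
      split_ifs with hm
      · rfl
      · exact hF m (by omega)
    rw [this]
    refine Submodule.sum_mem _ fun n hn => Submodule.smul_mem _ _ (Submodule.subset_span ?_)
    exact Finset.mem_coe.mpr (Finset.mem_image_of_mem _ hn)
  have := FiniteDimensional.span_finset K
    ((Finset.range (D + 1)).image fun n => (X : PowerSeries K) ^ n)
  exact Module.Finite.iff_fg.mp (Submodule.finiteDimensional_of_le h)

theorem mul_mem_degreeLE {D E : ℕ} {F G : PowerSeries K} (hF : F ∈ degreeLE K D)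
    (hG : G ∈ degreeLE K E) : F * G ∈ degreeLE K (D + E) := by
  intro n hn
  rw [coeff_mul]
  refine Finset.sum_eq_zero fun x hx => ?_
  rw [Finset.HasAntidiagonal.mem_antidiagonal] at hx
  rcases lt_or_ge D x.1 with h | h
  · rw [hF _ h, zero_mul]
  · rw [hG _ (by omega), mul_zero]

theorem pow_mem_degreeLE {D : ℕ} {F : PowerSeries K} (hF : F ∈ degreeLE K D) (k : ℕ) :
    F ^ k ∈ degreeLE K (k * D) := by
  induction k with
  | zero => intro n hn; simp [coeff_one]; omega
  | succ k ih => rw [pow_succ, add_mul, one_mul]; exact mul_mem_degreeLE ih hF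

theorem cartier_mem_degreeLE [PerfectRing K p] {D : ℕ} {F : PowerSeries K}
    (hF : F ∈ degreeLE K (p * D)) (i : ℕ) : cartier p i F ∈ degreeLE K D := by
  intro n hn
  have : p * D < p * n := Nat.mul_lt_mul_of_pos_left hn (Fact.out : p.Prime).pos
  rw [coeff_cartier, hF _ (by omega), map_zero]

theorem degreeLE_mono {D E : ℕ} (h : D ≤ E) : degreeLE K D ≤ degreeLE K E :=
  fun _ hF n hn => hF n (h.trans_lt hn)

theorem coe_mem_degreeLE {f : Polynomial K} {D : ℕ} (h : f.natDegree ≤ D) :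
    (f : PowerSeries K) ∈ degreeLE K D := by
  intro n hn
  rw [Polynomial.coeff_coe, Polynomial.coeff_eq_zero_of_natDegree_lt (h.trans_lt hn)]

/-- Some multiple `y • A` is integral, so its powers lie in a finitely generated module; the factors
`y ^ e j` go into the coefficients. With `e j = p ^ j` this gives an additive relation. -/
theorem IsAlgebraic.exists_sum_smul_pow_eq_zero {R S : Type*} [CommRing R] [IsDomain R]
    [CommRing S] [Algebra R S] {A : S} (hA : IsAlgebraic R A) (e : ℕ → ℕ) :
    ∃ (N : ℕ) (g : ℕ → R), ∑ j ∈ Finset.range N, g j • A ^ e j = 0 ∧ ∃ j < N, g j ≠ 0 := by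
  obtain ⟨y, hy, hint⟩ := hA.exists_integral_multiple
  obtain ⟨s, hs⟩ := hint.fg_adjoin_singleton
  have hdep : ¬ LinearIndependent R fun j : Fin (s.card + 1) => (y • A) ^ e j := by
    intro hli
    have := linearIndependent_le_span_aux' _ hli (s : Set S) (Set.range_subset_iff.mpr fun j => by
      rw [hs]
      exact Subalgebra.pow_mem _ (Algebra.self_mem_adjoin_singleton R _) _)
    simp at this
  obtain ⟨g, hg, i, hi⟩ := Fintype.not_linearIndependent_iff.mp hdep
  refine ⟨s.card + 1, fun j => if h : j < s.card + 1 then g ⟨j, h⟩ * y ^ e j else 0, ?_, i, i.2, ?_⟩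
  · rw [Finset.sum_range, ← hg]
    refine Finset.sum_congr rfl fun j _ => ?_
    beta_reduce
    rw [dif_pos j.2, smul_pow, mul_smul]
  · beta_reduce
    rw [dif_pos i.2]
    exact mul_ne_zero hi (pow_ne_zero _ hy)

/-- If `g 0 = 0`, every power of `A` left is a `p`-th power, so a Cartier operator lowers each
exponent `p ^ (j + 1)` to `p ^ j`. Choosing `i` that does not kill some nonzero `g j` keeps the
relation nontrivial. -/
theorem exists_sum_mul_pow_char_eq_zero_of_ne_zero [PerfectRing K p] {A : PowerSeries K} {D : ℕ}
    (N : ℕ) (g : ℕ → PowerSeries K) (hg : ∀ j, g j ∈ degreeLE K D)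
    (hsum : ∑ j ∈ Finset.range N, g j * A ^ p ^ j = 0) (hne : ∃ j < N, g j ≠ 0) :
    ∃ (M : ℕ) (c : ℕ → PowerSeries K), (∀ j, c j ∈ degreeLE K D) ∧ c 0 ≠ 0 ∧
      ∑ j ∈ Finset.range (M + 1), c j * A ^ p ^ j = 0 := by
  induction N generalizing g with
  | zero => obtain ⟨j, hj, -⟩ := hne; omega
  | succ N ih =>
    by_cases h0 : g 0 = 0
    · obtain ⟨j, hj, hgj⟩ := hne
      obtain ⟨k, rfl⟩ : ∃ k, j = k + 1 :=
        Nat.exists_eq_succ_of_ne_zero (by rintro rfl; exact hgj h0)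
      obtain ⟨i, hi, hci⟩ := exists_cartier_ne_zero p hgj
      refine ih (fun j => cartier p i (g (j + 1))) (fun j => ?_) ?_ ⟨k, by omega, hci⟩
      · refine cartier_mem_degreeLE p (degreeLE_mono ?_ (hg _)) i
        exact Nat.le_mul_of_pos_left D (Fact.out : p.Prime).pos
      · rw [Finset.sum_range_succ', h0, zero_mul, add_zero] at hsum
        have := congrArg (cartier p i) hsum
        simpa only [map_sum, map_zero, pow_succ, pow_mul, cartier_mul_pow_char p hi] using this
    · exact ⟨N, g, hg, h0, hsum⟩

/-- The space is `V = {F | c 0 * F ∈ U}`. Since `c 0 * cartier p i F = cartier p i (c 0 ^ (p - 1) *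
(c 0 * F))`, it suffices that `u ↦ cartier p i (c 0 ^ (p - 1) * u)` preserves `U`. -/
theorem exists_cartier_stable_of_sum_eq_zero [PerfectRing K p] {A : PowerSeries K} {D M : ℕ}
    {c : ℕ → PowerSeries K} (hc : ∀ j, c j ∈ degreeLE K D) (h0 : c 0 ≠ 0)
    (hsum : ∑ j ∈ Finset.range (M + 1), c j * A ^ p ^ j = 0) :
    ∃ V : Submodule K (PowerSeries K), V.FG ∧ (∀ i < p, ∀ F ∈ V, cartier p i F ∈ V) ∧ A ∈ V := by
  classical
  have hp : 2 ≤ p := (Fact.out : p.Prime).two_le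
  let T : Submodule K (PowerSeries K) :=
    Submodule.span K ((Finset.range (M + 1)).image fun j => A ^ p ^ j : Finset (PowerSeries K))
  have hT : ∀ j ≤ M, A ^ p ^ j ∈ T := fun j hj => Submodule.subset_span <| by
    exact Finset.mem_coe.mpr (Finset.mem_image_of_mem _ (Finset.mem_range.mpr (by omega)))
  let U : Submodule K (PowerSeries K) := degreeLE K D * T
  have hU : U.FG := (degreeLE_fg D).mul ⟨_, rfl⟩
  have hpow : ∀ i < p, ∀ j < M, ∀ b ∈ degreeLE K (p * D),
      cartier p i (b * A ^ p ^ (j + 1)) ∈ U := by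
    intro i hi j hj b hb
    rw [pow_succ, pow_mul, cartier_mul_pow_char p hi]
    exact Submodule.mul_mem_mul (cartier_mem_degreeLE p hb i) (hT j hj.le)
  have hstable : ∀ i < p, ∀ u ∈ U, cartier p i (c 0 ^ (p - 1) * u) ∈ U := by
    intro i hi u hu
    induction hu using Submodule.mul_induction_on' with
    | mem_mul_mem b hb t ht =>
      induction ht using Submodule.span_induction with
      | mem t ht =>
        obtain ⟨j, hj, rfl⟩ := Finset.mem_image.mp (Finset.mem_coe.mp ht)
        rw [Finset.mem_range] at hj
        rcases j with _ | j
        -- `A` itself is not a `p`-th power; one factor `c 0` is spent to trade it for higher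
        -- powers. The degree bound is `(p - 2) * D + D + D = p * D`, which the Cartier operator
        -- brings back to `D`.
        · have hrel : c 0 ^ (p - 1) * (b * A ^ p ^ 0) =
              -∑ j ∈ Finset.range M, c 0 ^ (p - 2) * b * c (j + 1) * A ^ p ^ (j + 1) := by
            rw [Finset.sum_range_succ'] at hsum
            have h1 : p - 1 = p - 2 + 1 := by omega
            simp only [mul_assoc, ← Finset.mul_sum]
            rw [eq_neg_of_add_eq_zero_left hsum, h1, pow_succ]
            ring
          rw [hrel, map_neg, map_sum]
          refine neg_mem (Submodule.sum_mem _ fun j hj => ?_)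
          refine hpow i hi j (Finset.mem_range.mp hj) _ (degreeLE_mono (le_of_eq ?_)
            (mul_mem_degreeLE (mul_mem_degreeLE (pow_mem_degreeLE (hc 0) (p - 2)) hb) (hc (j + 1))))
          obtain ⟨q, rfl⟩ := Nat.exists_eq_add_of_le hp
          simp only [Nat.add_sub_cancel_left]
          ring
        · rw [← mul_assoc]
          refine hpow i hi j (by omega) _ (degreeLE_mono (le_of_eq ?_)
            (mul_mem_degreeLE (pow_mem_degreeLE (hc 0) (p - 1)) hb))
          obtain ⟨q, rfl⟩ := Nat.exists_eq_add_of_le hp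
          have : 2 + q - 1 = q + 1 := by omega
          rw [this]
          ring
      | zero => simp
      | add F G _ _ hF hG => rw [mul_add, mul_add, map_add]; exact add_mem hF hG
      | smul a F _ hF =>
        rw [mul_smul_comm, mul_smul_comm, cartier_smul]; exact Submodule.smul_mem _ _ hF
    | add F _ G _ hF hG => rw [mul_add, map_add]; exact add_mem hF hG
  refine ⟨U.comap (LinearMap.mulLeft K (c 0)), ?_, ?_, ?_⟩
  · have : FiniteDimensional K U := Module.Finite.iff_fg.mpr hU
    have : FiniteDimensional K (LinearMap.mulLeft K (c 0)).ker := by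
      rw [LinearMap.ker_eq_bot.mpr (mul_right_injective₀ h0)]
      infer_instance
    exact Module.Finite.iff_fg.mp inferInstance
  · intro i hi F hF
    rw [Submodule.mem_comap, LinearMap.mulLeft_apply] at hF ⊢
    have h := hstable i hi _ hF
    rwa [← mul_assoc, ← pow_succ, Nat.sub_add_cancel (by omega), mul_comm (c 0 ^ p),
      cartier_mul_pow_char p hi, mul_comm] at h
  · rw [Submodule.mem_comap, LinearMap.mulLeft_apply]
    simpa using Submodule.mul_mem_mul (hc 0) (hT 0 (Nat.zero_le M))

theorem exists_cartier_stable_of_isAlgebraic [PerfectRing K p] {A : PowerSeries K}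
    (hA : IsAlgebraic (Polynomial K) A) :
    ∃ V : Submodule K (PowerSeries K), V.FG ∧ (∀ i < p, ∀ F ∈ V, cartier p i F ∈ V) ∧ A ∈ V := by
  obtain ⟨N, g, hsum, j, hj, hgj⟩ :=
    IsAlgebraic.exists_sum_smul_pow_eq_zero hA fun j => p ^ j
  -- Truncation makes one degree bound valid for all indices, as `g` is arbitrary beyond `N`.
  let f : ℕ → Polynomial K := fun k => if k < N then g k else 0
  obtain ⟨M, c, hc, h0, hc'⟩ := exists_sum_mul_pow_char_eq_zero_of_ne_zero p (A := A)
    (D := (Finset.range N).sup fun k => (g k).natDegree) N (fun k => (f k : PowerSeries K))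
    (fun k => coe_mem_degreeLE <| by
      by_cases hk : k < N
      · simpa [f, hk] using
          Finset.le_sup (f := fun k => (g k).natDegree) (Finset.mem_range.mpr hk)
      · simp [f, hk])
    (by
      rw [← hsum]
      refine Finset.sum_congr rfl fun k hk => ?_
      simp [f, Finset.mem_range.mp hk, Algebra.smul_def, algebraMap_apply'])
    ⟨j, hj, by simpa [f, hj] using hgj⟩
  exact exists_cartier_stable_of_sum_eq_zero p hc h0 hc'

theorem IsAlgebraic.shuffle [PerfectRing K p] {A B : PowerSeries K}
    (hA : IsAlgebraic (Polynomial K) A) (hB : IsAlgebraic (Polynomial K) B) :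
    IsAlgebraic (Polynomial K) (shuffle A B) := by
  obtain ⟨V, hVfg, hV, hAV⟩ := exists_cartier_stable_of_isAlgebraic p hA
  obtain ⟨W, hWfg, hW, hBW⟩ := exists_cartier_stable_of_isAlgebraic p hB
  exact isAlgebraic_of_mem_cartier_stable p (hVfg.map₂ shuffleBilin hWfg)
    (fun i hi F hF => cartier_mem_map₂_shuffleBilin p hV hW hi hF)
    (Submodule.apply_mem_map₂ shuffleBilin hAV hBW)

end Algebraic

end PowerSeries

theorem mainTheorem5 (p : ℕ) [Fact p.Prime]
    (A B : PowerSeries (AlgebraicClosure (ZMod p)))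
    (hA : IsAlgebraic (Polynomial (AlgebraicClosure (ZMod p))) A)
    (hB : IsAlgebraic (Polynomial (AlgebraicClosure (ZMod p))) B) :
    IsAlgebraic (Polynomial (AlgebraicClosure (ZMod p))) (PowerSeries.shuffle A B) :=
  PowerSeries.IsAlgebraic.shuffle p hA hB
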